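/- **Lemma (Incompressibility of Haar random states).** For $n\in\mathbb N$ let $\mathcal H_n=\mathbb C^{2^n}$ be the space of $n$ qubits, and let a random pure state $|\psi\rangle\in\mathcal H_n$ be Haar distributed, i.e. uniform on the unit sphere of $\mathbb C^{2^n}$. A channel from $n$ to $m$ qubits is a completely positive trace-preserving linear map from operators on $\mathcal H_n$ to operators on $\mathcal H_m$, and $F(\rho,\sigma)=\big(\mathrm{Tr}\sqrt{\sqrt\rho\,\sigma\sqrt\rho}\big)^2$ is the fidelity. For channels $\mathsf{Comp}$ from $n$ to $m$ qubits and $\mathsf{Decomp}$ from $m$ to $n$ qubits put $$f(\psi)=F\big(|\psi\rangle\langle\psi|,\ (\mathsf{Decomp}\circ\mathsf{Comp})(|\psi\rangle\langle\psi|)\big),\qquad F_{\mathrm{avg}}=\mathbb E_\psi f(\psi).$$ 1. (Average fidelity.) For all $m<n$ and all such $\mathsf{Comp},\mathsf{Decomp}$, the function $f$ is integrable and $$F_{\mathrm{avg}}\le\frac{2^m+1}{2^n+1}.$$ 2. (Concentration.) For all $m<n$, all such $\mathsf{Comp},\mathsf{Decomp}$ and all $t>0$, $$\Pr_\psi\big[\,|f(\psi)-F_{\mathrm{avg}}|\ge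 t\,\big]\le 2\exp\Big(-\frac{4C\,2^n\,t^2}{4^2}\Big),\qquad C=\frac1{18\pi^3}.$$ 3. (Incompressibility.) Let $\varepsilon:\mathbb N\to\mathbb R$ be negligible (that is, $n^c\varepsilon(n)\to0$ as $n\to\infty$ for every $c\in\mathbb N$) and let $p$ be a real polynomial with $p(n)>0$ for all large $n$. Then there is $N$ such that for all $n\ge N$ and all $m<n$ there do not exist channels $\mathsf{Comp}$ from $n$ to $m$ qubits and $\mathsf{Decomp}$ from $m$ to $n$ qubits with $$\Pr_\psi\big[f(\psi)\ge1-\varepsilon(n)\big]\ge\frac1{p(n)}.$$ -/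

import Mathlib

open MeasureTheory Filter Topology Polynomial
open scoped ComplexOrder MatrixOrder Matrix.Norms.L2Operator CStarAlgebra

noncomputable section

/-- Operators on the Hilbert space of `n` qubits, of dimension `2 ^ n`, as matrices in the
computational basis. -/
abbrev QubitOp (n : ℕ) : Type := Matrix (Fin (2 ^ n)) (Fin (2 ^ n)) ℂ

/-- State vectors of `n` qubits: the unit sphere of `ℂ ^ (2 ^ n)`. -/
abbrev StateVec (n : ℕ) : Type := Metric.sphere (0 : EuclideanSpace ℂ (Fin (2 ^ n))) 1

/-- A quantum channel from `n` qubits to `m` qubits: a completely positive, trace-preserving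
linear map. -/
structure QubitChannel (n m : ℕ) extends QubitOp n →CP QubitOp m where
  trace_map' : ∀ X : QubitOp n, (toLinearMap X).trace = X.trace

/-- The action of a channel on operators. -/
def QubitChannel.apply {n m : ℕ} (Φ : QubitChannel n m) (X : QubitOp n) : QubitOp m :=
  Φ.toLinearMap X

/-- The pure state `|ψ⟩⟨ψ|`. -/
def pureState {n : ℕ} (ψ : StateVec n) : QubitOp n :=
  Matrix.vecMulVec (fun i => ψ.1 i) (fun i => star (ψ.1 i))

/-- The (squared, Uhlmann) fidelity `F(ρ, σ) = (Tr √(√ρ σ √ρ))²`. -/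
def fidelity {n : ℕ} (ρ σ : QubitOp n) : ℝ :=
  (CFC.sqrt (CFC.sqrt ρ * σ * CFC.sqrt ρ)).trace.re ^ 2

/-- The law of a Haar-random pure state of `n` qubits: the uniform probability measure on the unit
sphere of `ℂ ^ (2 ^ n)`, that is, the surface measure divided by its total mass. -/
def haarState (n : ℕ) : Measure (StateVec n) :=
  ((Measure.addHaar : Measure (EuclideanSpace ℂ (Fin (2 ^ n)))).toSphere Set.univ)⁻¹ •
    (Measure.addHaar : Measure (EuclideanSpace ℂ (Fin (2 ^ n)))).toSphere

/-- The fidelity between `|ψ⟩⟨ψ|` and what is recovered from it by compressing and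
decompressing. -/
def recoveryFidelity {n m : ℕ} (Comp : QubitChannel n m) (Decomp : QubitChannel m n)
    (ψ : StateVec n) : ℝ :=
  fidelity (pureState ψ) (Decomp.apply (Comp.apply (pureState ψ)))

/-- The average of the recovery fidelity over Haar-random states. -/
def avgRecoveryFidelity {n m : ℕ} (Comp : QubitChannel n m) (Decomp : QubitChannel m n) : ℝ :=
  ∫ ψ, recoveryFidelity Comp Decomp ψ ∂(haarState n)

/-- `ε(n)` is negligible: it decays faster than every inverse power of `n`. -/
def Negligible (ε : ℕ → ℝ) : Prop :=
  Asymptotics.SuperpolynomialDecay atTop (fun n : ℕ => (n : ℝ)) ε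

end

open Matrix ProbabilityTheory

/-! Write d = 2^n. The composite channel has Kraus operators K_s = B_i A_j, and for a pure state the
fidelity is the quartic polynomial f(ψ) = ∑ |⟨ψ, K_s ψ⟩|². The factorization through the smaller
space enters only through κ = ∑ |tr K_s|² ≤ 2^n 2^m, by Cauchy–Schwarz for the Hilbert–Schmidt
product (`exists_kraus_recoveryFidelity`).

Neither moment formulas nor Lévy's lemma are used. Both the average and the concentration come from
one integration by parts. Invariance under exp(sA), A skew-Hermitian, says that derivatives along Aψ
integrate to zero. With ψ and its conjugate treated as independent variables, this extends to every
complex matrix in place of A. Matrix units, summed, give a Stein identity with weight exp(l f)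
(`haarState.integral_exp_mul_stein`).

Two instances of it, one for f and one for the quadratic form q of T = ∑ conj(tr K_s) K_s, combine
so that q cancels (`haarState.integral_exp_mul_krausForm_sub`): E[exp(l f) ((d + 1) f - (1 + κ/d) +
l R)] = 0, where |R| ≤ 8 by `norm_krausRemainder_le`. At l = 0 this is the exact average (1 +
κ/d)/(d + 1). For real l it bounds the logarithmic derivative of the centred moment generating
function by 8|l|/(d + 1), so f is sub-Gaussian with variance proxy 8/(d + 1)
(`hasSubgaussianMGF_of_abs_integral_mul_exp_le`). Chernoff's bound then gives exp(-(d + 1)t²/16),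
stronger than the stated tail. Incompressibility follows because the average is at most 2/3 while
the tail is doubly exponentially small in n. -/

/-! ### Kraus operators and the fidelity of a pure state -/

theorem CStarAlgebra.exists_eq_star_mul_self {A : Type*} [NonUnitalCStarAlgebra A] [PartialOrder A]
    [StarOrderedRing A] {a : A} (h : 0 ≤ a) : ∃ y, a = star y * y :=
  CStarAlgebra.nonneg_iff_eq_star_mul_self.mp h

theorem QubitChannel.exists_kraus {n m : ℕ} (Φ : QubitChannel n m) :
    ∃ K : Fin (2 ^ n) × Fin (2 ^ m) → Matrix (Fin (2 ^ m)) (Fin (2 ^ n)) ℂ,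
      (∀ X, Φ.apply X = ∑ s, K s * X * (K s)ᴴ) ∧ ∑ s, (K s)ᴴ * K s = 1 := by
  -- Only row 0 of V is nonzero, with entries E_{0b}, so `star V * V` is the block matrix (E_{ab}).
  -- Its image under Φ is the Choi matrix, and the rows of a factor Y of that image yield the Kraus
  -- operators.
  let V : CStarMatrix (Fin (2 ^ n)) (Fin (2 ^ n)) (QubitOp n) :=
    CStarMatrix.ofMatrix (Matrix.of fun i b => if i = 0 then Matrix.single 0 b 1 else 0)
  have hV : 0 ≤ star V * V := star_mul_self_nonneg V
  have hN := Φ.map_cstarMatrix_nonneg' _ _ hV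
  obtain ⟨Y, hY⟩ := CStarAlgebra.exists_eq_star_mul_self hN
  have hΦ : ∀ a b, Φ.toLinearMap (Matrix.single a b 1) = ∑ k, (Y k a)ᴴ * Y k b := by
    intro a b
    have h1 := congrFun (congrFun hY a) b
    have h2 : (star V * V) a b = Matrix.single a b (1 : ℂ) := by
      simp [CStarMatrix.mul_apply, V, CStarMatrix.star_apply, Matrix.star_eq_conjTranspose]
    rw [CStarMatrix.map_apply, h2] at h1
    rw [h1]
    simp [CStarMatrix.mul_apply, CStarMatrix.star_apply, Matrix.star_eq_conjTranspose]
  have key : ∀ X, Φ.apply X = ∑ s : Fin (2 ^ n) × Fin (2 ^ m),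
      (Matrix.of fun p a => star (Y s.1 a s.2 p)) * X *
        (Matrix.of fun p a => star (Y s.1 a s.2 p))ᴴ := by
    intro X
    have hX : Φ.apply X = ∑ a, ∑ b, X a b • ∑ k, (Y k a)ᴴ * Y k b := by
      conv_lhs => rw [Matrix.matrix_eq_sum_single X]
      simp only [QubitChannel.apply, map_sum, ← hΦ, ← map_smul, Matrix.smul_single, smul_eq_mul,
        mul_one]
    rw [hX]
    ext p q
    simp only [Matrix.sum_apply, Matrix.smul_apply, Matrix.mul_apply, Matrix.conjTranspose_apply,
      Matrix.of_apply, smul_eq_mul, Fintype.sum_prod_type, Finset.mul_sum, Finset.sum_mul,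
      star_star]
    have e1 : ∀ F : Fin (2 ^ n) → Fin (2 ^ n) → Fin (2 ^ n) → Fin (2 ^ m) → ℂ,
        ∑ a, ∑ b, ∑ k, ∑ r, F a b k r = ∑ k, ∑ r, ∑ b, ∑ a, F a b k r := by
      intro F
      calc _ = ∑ b, ∑ k, ∑ r, ∑ a, F a b k r := by
            rw [Finset.sum_comm]; refine Finset.sum_congr rfl fun b _ => ?_
            rw [Finset.sum_comm]; refine Finset.sum_congr rfl fun k _ => ?_
            rw [Finset.sum_comm]
        _ = _ := by
            rw [Finset.sum_comm]; refine Finset.sum_congr rfl fun k _ => ?_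
            rw [Finset.sum_comm]
    rw [e1]
    refine Finset.sum_congr rfl fun k _ => Finset.sum_congr rfl fun r _ =>
      Finset.sum_congr rfl fun b _ => Finset.sum_congr rfl fun a _ => ?_
    ring
  refine ⟨_, key, Matrix.ext_iff_trace_mul_right.mpr fun X => ?_⟩
  have h := Φ.trace_map' X
  rw [← QubitChannel.apply, key, Matrix.trace_sum] at h
  rw [one_mul, ← h, Finset.sum_mul, Matrix.trace_sum]
  exact Finset.sum_congr rfl fun s _ => (Matrix.trace_mul_cycle _ _ _).symm

theorem posSemidef_pureState {n : ℕ} (ψ : StateVec n) : (pureState ψ).PosSemidef :=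
  Matrix.posSemidef_vecMulVec_self_star _

theorem StateVec.star_dotProduct_self {n : ℕ} (ψ : StateVec n) :
    star ψ.1.ofLp ⬝ᵥ ψ.1.ofLp = 1 := by
  have h : ‖ψ.1‖ = 1 := norm_eq_of_mem_sphere ψ
  have := EuclideanSpace.inner_eq_star_dotProduct ψ.1 ψ.1
  rw [dotProduct_comm, ← this, inner_self_eq_norm_sq_to_K, h]
  simp

theorem pureState_mul_mul_pureState {n : ℕ} (ψ : StateVec n) (σ : QubitOp n) :
    pureState ψ * σ * pureState ψ = (star ψ.1.ofLp ⬝ᵥ σ *ᵥ ψ.1.ofLp) • pureState ψ := by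
  unfold pureState
  rw [Matrix.vecMulVec_mul, Matrix.vecMulVec_mul_vecMulVec, Matrix.vecMulVec_smul]
  congr 1
  exact (Matrix.dotProduct_mulVec _ _ _).symm

/-- A pure state P is a projection, hence its own square root, and PσP = cP with c = ⟨ψ, σψ⟩ ≥ 0,
whose square root is √c P. -/
theorem fidelity_pureState {n : ℕ} (ψ : StateVec n) {σ : QubitOp n} (hσ : σ.PosSemidef) :
    fidelity (pureState ψ) σ = (star ψ.1.ofLp ⬝ᵥ σ *ᵥ ψ.1.ofLp).re := by
  have hP : 0 ≤ pureState ψ := (posSemidef_pureState ψ).nonneg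
  have hPP : pureState ψ * pureState ψ = pureState ψ := by
    have := pureState_mul_mul_pureState ψ 1
    simpa [StateVec.star_dotProduct_self] using this
  have htr : (pureState ψ).trace = 1 := by
    have := StateVec.star_dotProduct_self ψ
    rw [dotProduct_comm] at this
    rwa [pureState, Matrix.trace_vecMulVec]
  have hs : CFC.sqrt (pureState ψ) = pureState ψ := CFC.sqrt_unique hPP hP
  set c := (star ψ.1.ofLp ⬝ᵥ σ *ᵥ ψ.1.ofLp) with hc
  have hc0 : 0 ≤ c := hσ.dotProduct_mulVec_nonneg _
  obtain ⟨h1, h2⟩ := Complex.nonneg_iff.mp hc0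
  have hcr : c = ((Real.sqrt c.re * Real.sqrt c.re : ℝ) : ℂ) := by
    rw [Real.mul_self_sqrt h1]; exact Complex.ext rfl (by simp [← h2])
  have hs2 : CFC.sqrt (c • pureState ψ) = ((Real.sqrt c.re : ℝ) : ℂ) • pureState ψ := by
    refine CFC.sqrt_unique ?_ ?_
    · rw [smul_mul_smul_comm, hPP, ← Complex.ofReal_mul, ← hcr]
    · exact ((posSemidef_pureState ψ).smul (by simp : (0:ℂ) ≤ ((Real.sqrt c.re : ℝ) : ℂ))).nonneg
  rw [fidelity, hs, pureState_mul_mul_pureState, ← hc, hs2, Matrix.trace_smul, htr]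
  simp [Real.sq_sqrt h1]

theorem Matrix.sum_sum_norm_sq_of_sum_conjTranspose_mul_self {σ p a : Type*} [Fintype σ] [Fintype p]
    [Fintype a] [DecidableEq a] {K : σ → Matrix p a ℂ} (hK : ∑ s, (K s)ᴴ * K s = 1) :
    ∑ s, ∑ i, ∑ j, ‖K s i j‖ ^ 2 = Fintype.card a := by
  have h := congrArg Matrix.trace hK
  rw [Matrix.trace_sum, Matrix.trace_one] at h
  simp only [Matrix.trace, Matrix.diag_apply, Matrix.mul_apply, Matrix.conjTranspose_apply,
    RCLike.star_def, Complex.conj_mul'] at h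
  have h2 : ((∑ s, ∑ i, ∑ j, ‖K s i j‖ ^ 2 : ℝ) : ℂ) = Fintype.card a := by
    rw [← h]; push_cast
    exact Finset.sum_congr rfl fun s _ => Finset.sum_comm
  exact_mod_cast h2

theorem Matrix.norm_trace_mul_sq_le {p a : Type*} [Fintype p] [Fintype a] (B : Matrix a p ℂ)
    (A : Matrix p a ℂ) :
    ‖(B * A).trace‖ ^ 2 ≤ (∑ i, ∑ j, ‖B i j‖ ^ 2) * ∑ i, ∑ j, ‖A i j‖ ^ 2 := by
  have h1 : ‖(B * A).trace‖ ≤ ∑ x : a × p, ‖B x.1 x.2‖ * ‖A x.2 x.1‖ := by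
    rw [Matrix.trace, Fintype.sum_prod_type]
    simp only [Matrix.diag_apply, Matrix.mul_apply]
    refine (norm_sum_le _ _).trans (Finset.sum_le_sum fun i _ => (norm_sum_le _ _).trans ?_)
    simp
  have h2 := Finset.sum_mul_sq_le_sq_mul_sq Finset.univ
    (fun x : a × p => ‖B x.1 x.2‖) (fun x => ‖A x.2 x.1‖)
  rw [Fintype.sum_prod_type (f := fun x : a × p => ‖B x.1 x.2‖ ^ 2),
    Fintype.sum_prod_type_right (f := fun x : a × p => ‖A x.2 x.1‖ ^ 2)] at h2
  exact (pow_le_pow_left₀ (norm_nonneg _) h1 2).trans h2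

/-- Compression followed by decompression has Kraus operators whose traces are controlled by the
compressed dimension. -/
theorem exists_kraus_recoveryFidelity {n m : ℕ} (Comp : QubitChannel n m)
    (Decomp : QubitChannel m n) :
    ∃ (σ : Type) (_ : Fintype σ) (K : σ → QubitOp n), ∑ s, (K s)ᴴ * K s = 1 ∧
      ∑ s, ‖(K s).trace‖ ^ 2 ≤ (2 : ℝ) ^ n * 2 ^ m ∧
      ∀ ψ : StateVec n, recoveryFidelity Comp Decomp ψ =
        ∑ s, ‖star ψ.1.ofLp ⬝ᵥ K s *ᵥ ψ.1.ofLp‖ ^ 2 := by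
  obtain ⟨A, hA, hA1⟩ := Comp.exists_kraus
  obtain ⟨B, hB, hB1⟩ := Decomp.exists_kraus
  refine ⟨_ × _, inferInstance, fun s => B s.1 * A s.2, ?_, ?_, fun ψ => ?_⟩
  · rw [Fintype.sum_prod_type_right]
    calc _ = ∑ i, (A i)ᴴ * (∑ j, (B j)ᴴ * B j) * A i := by
          refine Finset.sum_congr rfl fun i _ => ?_
          rw [Matrix.mul_sum, Matrix.sum_mul]
          refine Finset.sum_congr rfl fun j _ => ?_
          simp [Matrix.conjTranspose_mul, Matrix.mul_assoc]
      _ = 1 := by rw [hB1]; simpa using hA1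
  · have eA := Matrix.sum_sum_norm_sq_of_sum_conjTranspose_mul_self hA1
    have eB := Matrix.sum_sum_norm_sq_of_sum_conjTranspose_mul_self hB1
    rw [Fintype.card_fin] at eA eB
    push_cast at eA eB
    -- The squared Hilbert–Schmidt norms sum to 2^n over the A's and to 2^m over the B's, and the
    -- sum over pairs factorizes.
    rw [← eA, ← eB, mul_comm, Finset.sum_mul_sum, Fintype.sum_prod_type]
    exact Finset.sum_le_sum fun i _ => Finset.sum_le_sum fun j _ => Matrix.norm_trace_mul_sq_le _ _
  · have hσ : Decomp.apply (Comp.apply (pureState ψ)) =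
        ∑ s : (Fin (2 ^ m) × Fin (2 ^ n)) × (Fin (2 ^ n) × Fin (2 ^ m)),
          (B s.1 * A s.2) * pureState ψ * (B s.1 * A s.2)ᴴ := by
      rw [hB, hA, Fintype.sum_prod_type (α₁ := Fin (2 ^ m) × Fin (2 ^ n))]
      refine Finset.sum_congr rfl fun i _ => ?_
      rw [Matrix.mul_sum, Matrix.sum_mul]
      simp [Matrix.conjTranspose_mul, Matrix.mul_assoc]
    rw [recoveryFidelity, hσ, fidelity_pureState]
    · rw [Matrix.sum_mulVec, dotProduct_sum, Complex.re_sum]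
      refine Finset.sum_congr rfl fun s _ => ?_
      set M := B s.1 * A s.2
      have e : star ψ.1.ofLp ⬝ᵥ (M * pureState ψ * Mᴴ) *ᵥ ψ.1.ofLp =
          (star ψ.1.ofLp ⬝ᵥ M *ᵥ ψ.1.ofLp) * star (star ψ.1.ofLp ⬝ᵥ M *ᵥ ψ.1.ofLp) := by
        have h1 : pureState ψ = Matrix.vecMulVec ψ.1.ofLp (star ψ.1.ofLp) := rfl
        rw [h1, Matrix.mul_vecMulVec, Matrix.vecMulVec_mul, Matrix.vecMulVec_mulVec,
          dotProduct_smul, Matrix.star_dotProduct, star_star, Matrix.star_mulVec]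
        simp [mul_comm]
      rw [e, RCLike.star_def, Complex.mul_conj', ← Complex.ofReal_pow, Complex.ofReal_re]
    · exact Matrix.posSemidef_sum _ fun s _ =>
        (posSemidef_pureState ψ).mul_mul_conjTranspose_same _

/-! ### Unitary invariance of the uniform measure -/

-- A linear isometry maps Haar measure to a multiple of itself, and the multiple is 1 because the
-- unit ball is fixed. The surface measure of s is, up to a constant, the volume of the cone over s,
-- and isometries carry cones to cones.
open scoped Pointwise in
theorem MeasureTheory.Measure.measurePreserving_toSphere {E : Type*}
    [NormedAddCommGroup E] [NormedSpace ℝ E] [FiniteDimensional ℝ E] [MeasurableSpace E]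
    [BorelSpace E] (μ : Measure E) [μ.IsAddHaarMeasure] (U : E ≃ₗᵢ[ℝ] E)
    (T : Metric.sphere (0 : E) 1 → Metric.sphere (0 : E) 1) (hT : ∀ x, (T x : E) = U x) :
    MeasurePreserving T μ.toSphere μ.toSphere := by
  have hTc : Continuous T := continuous_induced_rng.mpr <| by
    have : (Subtype.val ∘ T) = fun x : Metric.sphere (0 : E) 1 => U x := funext hT
    rw [this]; fun_prop
  have hU : μ.map U = μ := by
    have hH : (μ.map U).IsAddHaarMeasure :=
      U.toContinuousLinearEquiv.isAddHaarMeasure_map μ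
    have h1 := Measure.isAddLeftInvariant_eq_smul (μ.map U) μ
    have h2 : (μ.map U) (Metric.ball 0 1) = μ (Metric.ball 0 1) := by
      rw [Measure.map_apply U.continuous.measurable measurableSet_ball]
      congr 1; ext x; simp
    have h3 := congrArg (fun ν : Measure E => ν (Metric.ball 0 1)) h1
    simp only [h2, Measure.smul_apply] at h3
    have h0 : μ (Metric.ball 0 1) ≠ 0 := (Metric.measure_ball_pos μ 0 one_pos).ne'
    have ht : μ (Metric.ball 0 1) ≠ ⊤ := measure_ball_lt_top.ne
    have hc : Measure.addHaarScalarFactor (μ.map U) μ = 1 := by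
      have h4 : (Measure.addHaarScalarFactor (μ.map U) μ : ENNReal) = 1 := by
        have h5 : (Measure.addHaarScalarFactor (μ.map U) μ : ENNReal) * μ (Metric.ball 0 1)
            = 1 * μ (Metric.ball 0 1) := by rw [one_mul]; exact h3.symm
        exact (ENNReal.mul_left_inj h0 ht).mp h5
      exact_mod_cast h4
    rw [h1, hc, one_smul]
  refine ⟨hTc.measurable, Measure.ext fun s hs => ?_⟩
  rw [Measure.map_apply hTc.measurable hs, Measure.toSphere_apply' _ (hTc.measurable hs),
    Measure.toSphere_apply' _ hs]
  congr 1
  have hset : Set.Ioo (0 : ℝ) 1 • ((↑) '' (T ⁻¹' s) : Set E) =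
      U ⁻¹' (Set.Ioo (0 : ℝ) 1 • ((↑) '' s)) := by
    ext x
    simp only [Set.mem_smul, Set.mem_image, Set.mem_preimage]
    constructor
    · rintro ⟨r, hr, _, ⟨y, hy, rfl⟩, rfl⟩
      exact ⟨r, hr, _, ⟨T y, hy, rfl⟩, by simp [hT]⟩
    · rintro ⟨r, hr, _, ⟨y, hy, rfl⟩, h⟩
      have hz : U.symm y ∈ Metric.sphere (0 : E) 1 := by simp
      refine ⟨r, hr, _, ⟨⟨U.symm y, hz⟩, ?_, rfl⟩, ?_⟩
      · have : T ⟨U.symm y, hz⟩ = y := Subtype.ext (by simp [hT])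
        rwa [this]
      · apply U.injective; simp [← h]
  rw [hset]
  have := U.toHomeomorph.toMeasurableEquiv.map_apply (μ := μ) (Set.Ioo (0 : ℝ) 1 • ((↑) '' s))
  change (μ.map U) _ = μ (U ⁻¹' _) at this
  rw [← this, hU]

instance haarState.instIsProbabilityMeasure (n : ℕ) : IsProbabilityMeasure (haarState n) := by
  refine ⟨?_⟩
  rw [haarState, Measure.smul_apply, smul_eq_mul]
  refine ENNReal.inv_mul_cancel ?_ (measure_ne_top _ _)
  exact fun h => Measure.toSphere_ne_zero _ (Measure.measure_univ_eq_zero.mp h)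

theorem Continuous.integrable_haarState {n : ℕ} {F : Type*} [NormedAddCommGroup F]
    {g : StateVec n → F} (hg : Continuous g) :
    Integrable g (haarState n) :=
  hg.integrable_of_hasCompactSupport (HasCompactSupport.of_compactSpace g)

/-- The action of a unitary matrix on state vectors. -/
noncomputable def StateVec.unitaryMap {n : ℕ} {U : QubitOp n}
    (hU : U ∈ Matrix.unitaryGroup (Fin (2 ^ n)) ℂ) (ψ : StateVec n) : StateVec n :=
  ⟨WithLp.toLp 2 (U *ᵥ ψ.1.ofLp), by
    have h : star (U *ᵥ ψ.1.ofLp) ⬝ᵥ (U *ᵥ ψ.1.ofLp) = 1 := by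
      rw [Matrix.star_mulVec, ← Matrix.dotProduct_mulVec, Matrix.mulVec_mulVec,
        ← Matrix.star_eq_conjTranspose, (Matrix.mem_unitaryGroup_iff').mp hU, Matrix.one_mulVec,
        StateVec.star_dotProduct_self]
    rw [dotProduct_comm, ← EuclideanSpace.inner_toLp_toLp, inner_self_eq_norm_sq_to_K] at h
    rw [mem_sphere_zero_iff_norm]
    have h2 : ‖WithLp.toLp 2 (U *ᵥ ψ.1.ofLp)‖ = 1 ∨ ‖WithLp.toLp 2 (U *ᵥ ψ.1.ofLp)‖ = -1 := by
      simpa using congrArg norm h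
    exact h2.resolve_right fun h => by
      linarith [norm_nonneg (WithLp.toLp 2 (U *ᵥ ψ.1.ofLp))]⟩

theorem StateVec.measurePreserving_unitaryMap {n : ℕ} {U : QubitOp n}
    (hU : U ∈ Matrix.unitaryGroup (Fin (2 ^ n)) ℂ) :
    MeasurePreserving (StateVec.unitaryMap hU) (haarState n) (haarState n) := by
  let W : EuclideanSpace ℂ (Fin (2 ^ n)) ≃ₗᵢ[ℂ] EuclideanSpace ℂ (Fin (2 ^ n)) :=
    Unitary.linearIsometryEquiv ⟨Matrix.toEuclideanCLM (𝕜 := ℂ) U, Unitary.map_mem _ hU⟩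
  let W' : EuclideanSpace ℂ (Fin (2 ^ n)) ≃ₗᵢ[ℝ] EuclideanSpace ℂ (Fin (2 ^ n)) :=
    { W.toLinearEquiv.restrictScalars ℝ with norm_map' := W.norm_map }
  refine (Measure.measurePreserving_toSphere Measure.addHaar W' _ fun x => ?_).smul_measure
    _
  rfl

theorem haarState.integral_comp_unitaryMap {n : ℕ} {U : QubitOp n}
    (hU : U ∈ Matrix.unitaryGroup (Fin (2 ^ n)) ℂ) {g : StateVec n → ℂ} (hg : Continuous g) :
    ∫ ψ, g (StateVec.unitaryMap hU ψ) ∂(haarState n) = ∫ ψ, g ψ ∂(haarState n) := by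
  have h := StateVec.measurePreserving_unitaryMap hU
  rw [← integral_map h.measurable.aemeasurable (by
    rw [h.map_eq]; exact hg.integrable_haarState.aestronglyMeasurable), h.map_eq]

/-! ### Infinitesimal invariance and Stein's identity -/

/-- The integral of P along the unitary flow exp(sA) is constant in s; differentiate under the
integral at s = 0. -/
theorem haarState.integral_fderiv_skewAdjoint {n : ℕ}
    {P : (Fin (2 ^ n) → ℂ) × (Fin (2 ^ n) → ℂ) → ℂ} (hP : ContDiff ℂ 1 P) {A : QubitOp n}
    (hA : Aᴴ = -A) :
    ∫ ψ : StateVec n, fderiv ℂ P (ψ.1.ofLp, star ψ.1.ofLp)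
      (A *ᵥ ψ.1.ofLp, star (A *ᵥ ψ.1.ofLp)) ∂(haarState n) = 0 := by
  set U : ℝ → QubitOp n := fun s => NormedSpace.exp (s • A) with hUdef
  let _ : NormedAlgebra ℚ (QubitOp n) := NormedAlgebra.restrictScalars ℚ ℂ _
  have hU : ∀ s, U s ∈ Matrix.unitaryGroup (Fin (2 ^ n)) ℂ := fun s =>
    NormedSpace.exp_mem_unitary_of_mem_skewAdjoint (skewAdjoint.smul_mem s
      (by rw [skewAdjoint.mem_iff, Matrix.star_eq_conjTranspose, hA]))
  have hU' : ∀ s, HasDerivAt U (A * U s) s := fun s => hasDerivAt_exp_smul_const' A s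
  set G : StateVec n → ℂ := fun ψ => fderiv ℂ P (ψ.1.ofLp, star ψ.1.ofLp)
      (A *ᵥ ψ.1.ofLp, star (A *ᵥ ψ.1.ofLp)) with hG
  have hGc : Continuous G := by
    have h1 := hP.continuous_fderiv (by norm_num)
    fun_prop
  obtain ⟨C, hC⟩ : ∃ C, ∀ ψ, ‖G ψ‖ ≤ C := by
    obtain ⟨C, hC⟩ := (isCompact_range hGc).isBounded.exists_norm_le
    exact ⟨C, fun ψ => hC _ ⟨ψ, rfl⟩⟩
  set F : StateVec n → ℂ := fun ψ => P (ψ.1.ofLp, star ψ.1.ofLp) with hF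
  have hFc : Continuous F := by
    have := hP.continuous
    fun_prop
  have hmul : ∀ (ψ : StateVec n) (s : ℝ),
      HasDerivAt (fun s => U s *ᵥ ψ.1.ofLp) (A *ᵥ (U s *ᵥ ψ.1.ofLp)) s := by
    intro ψ s
    let L : QubitOp n →L[ℝ] (Fin (2 ^ n) → ℂ) := LinearMap.toContinuousLinearMap
      { toFun := fun M => M *ᵥ ψ.1.ofLp
        map_add' := fun M N => Matrix.add_mulVec M N _
        map_smul' := fun c M => Matrix.smul_mulVec c M _ }
    have := L.hasFDerivAt.comp_hasDerivAt s (hU' s)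
    rw [Matrix.mulVec_mulVec]
    exact this
  have hder : ∀ (ψ : StateVec n) (s : ℝ), HasDerivAt
      (fun s => F (StateVec.unitaryMap (hU s) ψ)) (G (StateVec.unitaryMap (hU s) ψ)) s := by
    intro ψ s
    have h1 := (hmul ψ s).prodMk (hmul ψ s).star
    have h2 := ((hP.differentiable (by norm_num)) (U s *ᵥ ψ.1.ofLp,
      star (U s *ᵥ ψ.1.ofLp))).hasFDerivAt.restrictScalars ℝ
    exact h2.comp_hasDerivAt s h1
  have hmeas : ∀ (g : StateVec n → ℂ), Continuous g → ∀ s, AEStronglyMeasurable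
      (fun ψ => g (StateVec.unitaryMap (hU s) ψ)) (haarState n) := fun g hg s =>
    hg.integrable_haarState.aestronglyMeasurable.comp_measurePreserving
      (StateVec.measurePreserving_unitaryMap (hU s))
  have key := hasDerivAt_integral_of_dominated_loc_of_deriv_le (μ := haarState n) (x₀ := (0 : ℝ))
    (F := fun s ψ => F (StateVec.unitaryMap (hU s) ψ))
    (F' := fun s ψ => G (StateVec.unitaryMap (hU s) ψ)) (bound := fun _ => C) univ_mem
    (Eventually.of_forall fun s => hmeas F hFc s)
    ((StateVec.measurePreserving_unitaryMap (hU 0)).integrable_comp_of_integrable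
      hFc.integrable_haarState) (hmeas G hGc 0)
    (ae_of_all _ fun ψ s _ => hC _) (integrable_const _) (ae_of_all _ fun ψ s _ => hder ψ s)
  have h1 := key.2
  simp_rw [haarState.integral_comp_unitaryMap (hU _) hFc,
    haarState.integral_comp_unitaryMap (hU _) hGc] at h1
  exact h1.unique (hasDerivAt_const _ _)

/-- Infinitesimal unitary invariance of the law of a random state, complexified. -/
theorem haarState.integral_fderiv_mulVec {n : ℕ}
    {P : (Fin (2 ^ n) → ℂ) × (Fin (2 ^ n) → ℂ) → ℂ} (hP : ContDiff ℂ 1 P) (X : QubitOp n) :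
    ∫ ψ : StateVec n, fderiv ℂ P (ψ.1.ofLp, star ψ.1.ofLp)
      (X *ᵥ ψ.1.ofLp, -(star ψ.1.ofLp ᵥ* X)) ∂(haarState n) = 0 := by
  have hskew : ∀ A : QubitOp n, Aᴴ = -A →
      ∫ ψ : StateVec n, fderiv ℂ P (ψ.1.ofLp, star ψ.1.ofLp)
        (A *ᵥ ψ.1.ofLp, -(star ψ.1.ofLp ᵥ* A)) ∂(haarState n) = 0 := by
    intro A hA
    rw [← haarState.integral_fderiv_skewAdjoint hP hA]
    simp_rw [Matrix.star_mulVec, hA, Matrix.vecMul_neg]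
  -- X = A₁ + iA₂ with both parts skew-Hermitian. Writing the second direction as -(ψ* X), without
  -- conjugating X, makes the integrand complex linear in X, so the skew-Hermitian case suffices.
  set A₁ : QubitOp n := (1 / 2 : ℂ) • (X - Xᴴ)
  set A₂ : QubitOp n := (-Complex.I / 2 : ℂ) • (X + Xᴴ)
  have h₁ : A₁ᴴ = -A₁ := by
    simp [A₁, Matrix.conjTranspose_smul, ← smul_neg]
  have h₂ : A₂ᴴ = -A₂ := by
    simp [A₂, Matrix.conjTranspose_smul, neg_div, add_comm]
  have hX : X = A₁ + Complex.I • A₂ := by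
    ext i j
    simp only [A₁, A₂, Matrix.add_apply, Matrix.smul_apply, Matrix.sub_apply, smul_eq_mul]
    linear_combination (X i j + Xᴴ i j) / 2 * Complex.I_sq
  have hc := hP.continuous_fderiv (by norm_num)
  have hint : ∀ A : QubitOp n, Integrable (fun ψ : StateVec n =>
      fderiv ℂ P (ψ.1.ofLp, star ψ.1.ofLp) (A *ᵥ ψ.1.ofLp, -(star ψ.1.ofLp ᵥ* A)))
      (haarState n) := fun A => Continuous.integrable_haarState (by fun_prop)
  calc _ = ∫ ψ : StateVec n, (fderiv ℂ P (ψ.1.ofLp, star ψ.1.ofLp)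
          (A₁ *ᵥ ψ.1.ofLp, -(star ψ.1.ofLp ᵥ* A₁)) +
        Complex.I * fderiv ℂ P (ψ.1.ofLp, star ψ.1.ofLp)
          (A₂ *ᵥ ψ.1.ofLp, -(star ψ.1.ofLp ᵥ* A₂))) ∂(haarState n) := by
        congr 1; ext ψ
        rw [← smul_eq_mul, ← map_smul, ← map_add]
        congr 1
        conv_lhs => rw [hX]
        rw [Matrix.add_mulVec, Matrix.vecMul_add, Matrix.smul_mulVec Complex.I A₂,
          Matrix.vecMul_smul _ Complex.I A₂]
        ext <;> simp
        ring
    _ = 0 := by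
        rw [integral_add (hint _) ((hint _).const_mul _), integral_const_mul, hskew _ h₁,
          hskew _ h₂]
        simp

theorem fderiv_exp_mul_mul_fst {ι : Type*} [Fintype ι] [DecidableEq ι]
    {f t : (ι → ℂ) × (ι → ℂ) → ℂ} {z w : (ι → ℂ) × (ι → ℂ)}
    (hf : DifferentiableAt ℂ f z) (ht : DifferentiableAt ℂ t z) (l : ℂ) (i : ι) :
    fderiv ℂ (fun z => Complex.exp (l * f z) * (t z * z.1 i)) z w =
      Complex.exp (l * f z) *
        (l * fderiv ℂ f z w * (t z * z.1 i) + (fderiv ℂ t z w * z.1 i + t z * w.1 i)) := by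
  have h1 : HasFDerivAt (fun z : (ι → ℂ) × (ι → ℂ) => z.1 i)
      ((ContinuousLinearMap.proj (R := ℂ) (φ := fun _ : ι => ℂ) i).comp
        (ContinuousLinearMap.fst ℂ (ι → ℂ) (ι → ℂ))) z :=
    ((ContinuousLinearMap.proj (R := ℂ) (φ := fun _ : ι => ℂ) i).comp
        (ContinuousLinearMap.fst ℂ (ι → ℂ) (ι → ℂ))).hasFDerivAt
  have h2 := ((hf.hasFDerivAt.const_mul l).cexp).mul (ht.hasFDerivAt.mul h1)
  rw [show (fun z : (ι → ℂ) × (ι → ℂ) => Complex.exp (l * f z) * (t z * z.1 i)) =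
    (fun z => Complex.exp (l * f z)) * (t * fun z => z.1 i) from rfl, h2.fderiv]
  simp
  ring

/-- Moving along E_{ij} shifts x by x_j e_i and y by -y_i e_j. Summation over i collapses the y_i
x_i to 1, and differentiating the factor z_i produces the dimension term. -/
theorem sum_sum_fderiv_single {ι : Type*} [Fintype ι] [DecidableEq ι]
    {f : (ι → ℂ) × (ι → ℂ) → ℂ} {t : ι → (ι → ℂ) × (ι → ℂ) → ℂ}
    (hf : Differentiable ℂ f) (ht : ∀ j, Differentiable ℂ (t j)) (l : ℂ) {x y : ι → ℂ}
    (hxy : y ⬝ᵥ x = 1) :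
    ∑ i, ∑ j, fderiv ℂ (fun z => Complex.exp (l * f z) * (t j z * z.1 i)) (x, y)
        (Matrix.single i j 1 *ᵥ x, -(y ᵥ* Matrix.single i j 1)) =
      Complex.exp (l * f (x, y)) *
        (Fintype.card ι * ∑ j, t j (x, y) * x j + ∑ j, x j * fderiv ℂ (t j) (x, y) (x, 0) -
          ∑ j, fderiv ℂ (t j) (x, y) (0, Pi.single j 1) +
          l * (fderiv ℂ f (x, y) (x, 0) * ∑ j, t j (x, y) * x j -
            fderiv ℂ f (x, y) (0, fun j => t j (x, y)))) := by
  have hw : ∀ i j, ((Matrix.single i j 1 *ᵥ x, -(y ᵥ* Matrix.single i j 1)) :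
      (ι → ℂ) × (ι → ℂ)) = x j • (Pi.single i 1, 0) - y i • (0, Pi.single j 1) := by
    intro i j
    rw [Matrix.single_mulVec]
    ext k
    · simp [Pi.single_apply, Function.update_apply]
    · rcases eq_or_ne j k with rfl | h
      · simp [Matrix.vecMul, dotProduct, Matrix.single_apply]
      · simp [Matrix.vecMul, dotProduct, h, h.symm]
  have hsum : ∀ (L : (ι → ℂ) × (ι → ℂ) →L[ℂ] ℂ) (u : ι → ℂ),
      L (u, 0) = ∑ i, u i * L (Pi.single i 1, 0) ∧ L (0, u) = ∑ i, u i * L (0, Pi.single i 1) := by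
    intro L u
    have h1 : u = ∑ i, u i • (Pi.single i 1 : ι → ℂ) := pi_eq_sum_univ' u
    constructor
    · have := map_sum (L.comp (ContinuousLinearMap.inl ℂ _ _)) (fun i => u i • (Pi.single i 1 : ι → ℂ)) Finset.univ
      rw [← h1] at this
      simpa using this
    · have := map_sum (L.comp (ContinuousLinearMap.inr ℂ _ _)) (fun i => u i • (Pi.single i 1 : ι → ℂ)) Finset.univ
      rw [← h1] at this
      simpa using this
  simp_rw [fderiv_exp_mul_mul_fst (hf (x, y)) (ht _ (x, y)), hw, map_sub, map_smul, smul_eq_mul]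
  have hxy' : ∑ i, y i * x i = 1 := hxy
  rw [(hsum (fderiv ℂ f (x, y)) x).1, (hsum (fderiv ℂ f (x, y)) _).2]
  simp_rw [fun j => (hsum (fderiv ℂ (t j) (x, y)) x).1]
  set E := Complex.exp (l * f (x, y))
  set a : ι → ℂ := fun i => fderiv ℂ f (x, y) (Pi.single i 1, 0)
  set b : ι → ℂ := fun i => fderiv ℂ f (x, y) (0, Pi.single i 1)
  set T : ι → ℂ := fun j => t j (x, y)
  set p : ι → ι → ℂ := fun j i => fderiv ℂ (t j) (x, y) (Pi.single i 1, 0)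
  set q : ι → ι → ℂ := fun j i => fderiv ℂ (t j) (x, y) (0, Pi.single i 1)
  have hfst : ∀ i j : ι, (Matrix.single i j (1 : ℂ) *ᵥ x) i = x j := by
    intro i j
    rw [Matrix.single_mulVec]
    simp
  have e : ∀ i j, E * (l * (x j * a i - y i * b j) * (T j * x i) + ((x j * p j i - y i * q j j) * x i
      + T j * (x j * 1))) = E * (l * ((x i * a i) * (T j * x j)) - l * ((y i * x i) * (T j * b j)) +
        (x j * (x i * p j i)) - (y i * x i) * q j j + T j * x j) := by
    intro i j; ring
  calc _ = ∑ i, ∑ j, E * (l * ((x i * a i) * (T j * x j)) - l * ((y i * x i) * (T j * b j)) +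
        (x j * (x i * p j i)) - (y i * x i) * q j j + T j * x j) := by
        refine Finset.sum_congr rfl fun i _ => Finset.sum_congr rfl fun j _ => ?_
        rw [← e]
        simp only [a, b, T, p, q, hfst, mul_one]
    _ = E * (l * ((∑ i, x i * a i) * ∑ j, T j * x j) - l * ((∑ i, y i * x i) * ∑ j, T j * b j) +
        (∑ j, x j * ∑ i, x i * p j i) - (∑ i, y i * x i) * ∑ j, q j j +
          Fintype.card ι * ∑ j, T j * x j) := by
        have s1 : ∀ u v : ι → ℂ, ∑ i, ∑ j, l * (u i * v j) = l * ((∑ i, u i) * ∑ j, v j) := by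
          intro u v
          rw [Finset.sum_mul_sum, Finset.mul_sum]
          exact Finset.sum_congr rfl fun i _ => (Finset.mul_sum _ _ _).symm
        have s2 : ∑ i, ∑ j, x j * (x i * p j i) = ∑ j, x j * ∑ i, x i * p j i := by
          rw [Finset.sum_comm]
          exact Finset.sum_congr rfl fun i _ => (Finset.mul_sum _ _ _).symm
        have s3 : ∑ i, ∑ j, y i * x i * q j j = (∑ i, y i * x i) * ∑ j, q j j :=
          (Finset.sum_mul_sum _ _ _ _).symm
        have s4 : ∑ _i : ι, ∑ j, T j * x j = Fintype.card ι * ∑ j, T j * x j := by simp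
        simp only [← Finset.mul_sum _ _ E, Finset.sum_add_distrib, Finset.sum_sub_distrib]
        rw [s1 (fun i => x i * a i) (fun j => T j * x j),
          s1 (fun i => y i * x i) (fun j => T j * b j), s2, s3, s4]
    _ = _ := by rw [hxy']; ring

/-- Stein's identity for a random state, with respect to an exponential weight. -/
theorem haarState.integral_exp_mul_stein {n : ℕ}
    {f : (Fin (2 ^ n) → ℂ) × (Fin (2 ^ n) → ℂ) → ℂ}
    {t : Fin (2 ^ n) → (Fin (2 ^ n) → ℂ) × (Fin (2 ^ n) → ℂ) → ℂ}
    (hf : ContDiff ℂ 1 f) (ht : ∀ j, ContDiff ℂ 1 (t j)) (l : ℂ) :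
    ∫ ψ : StateVec n, (fun z : (Fin (2 ^ n) → ℂ) × (Fin (2 ^ n) → ℂ) => Complex.exp (l * f z) *
        (2 ^ n * ∑ j, t j z * z.1 j + ∑ j, z.1 j * fderiv ℂ (t j) z (z.1, 0) -
          ∑ j, fderiv ℂ (t j) z (0, Pi.single j 1) +
          l * (fderiv ℂ f z (z.1, 0) * ∑ j, t j z * z.1 j -
            fderiv ℂ f z (0, fun j => t j z)))) (ψ.1.ofLp, star ψ.1.ofLp) ∂(haarState n) = 0 := by
  have h1 : ∀ i j, ContDiff ℂ 1 (fun z : (Fin (2 ^ n) → ℂ) × (Fin (2 ^ n) → ℂ) =>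
      Complex.exp (l * f z) * (t j z * z.1 i)) := by
    intro i j
    have := ht j
    fun_prop
  have h2 : ∀ i j, Integrable (fun ψ : StateVec n => fderiv ℂ (fun z => Complex.exp (l * f z) *
      (t j z * z.1 i)) (ψ.1.ofLp, star ψ.1.ofLp) (Matrix.single i j 1 *ᵥ ψ.1.ofLp,
        -(star ψ.1.ofLp ᵥ* Matrix.single i j 1))) (haarState n) := by
    intro i j
    have := (h1 i j).continuous_fderiv (by norm_num)
    exact Continuous.integrable_haarState (by fun_prop)
  have h3 := fun ψ : StateVec n => sum_sum_fderiv_single (hf.differentiable (by norm_num))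
    (fun j => (ht j).differentiable (by norm_num)) l (StateVec.star_dotProduct_self ψ)
  rw [Fintype.card_fin] at h3
  push_cast at h3
  simp only [← h3]
  rw [integral_finsetSum _ fun i _ => integrable_finsetSum _ fun j _ => h2 i j]
  refine Finset.sum_eq_zero fun i _ => ?_
  rw [integral_finsetSum _ fun j _ => h2 i j]
  exact Finset.sum_eq_zero fun j _ => haarState.integral_fderiv_mulVec (h1 i j) _

/-! ### The fidelity polynomial and its derivatives -/

namespace Matrix

variable {ι σ : Type*} [Fintype ι] [Fintype σ]

/-- The bilinear form of a matrix, as a function of a pair of vectors. -/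
def pairForm (A : Matrix ι ι ℂ) (z : (ι → ℂ) × (ι → ℂ)) : ℂ := z.2 ⬝ᵥ A *ᵥ z.1

theorem contDiff_pairForm (A : Matrix ι ι ℂ) : ContDiff ℂ 1 (pairForm A) := by
  unfold pairForm dotProduct mulVec dotProduct
  fun_prop

theorem fderiv_pairForm (A : Matrix ι ι ℂ) (z w : (ι → ℂ) × (ι → ℂ)) :
    fderiv ℂ (pairForm A) z w = w.2 ⬝ᵥ A *ᵥ z.1 + z.2 ⬝ᵥ A *ᵥ w.1 := by
  rw [← ((contDiff_pairForm A).differentiable (by norm_num) z).lineDeriv_eq_fderiv, lineDeriv]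
  -- Along a line the form is a quadratic polynomial in s, whose linear coefficient is the
  -- derivative.
  have h : (fun s : ℂ => pairForm A (z + s • w)) = fun s =>
      pairForm A z + s * (w.2 ⬝ᵥ A *ᵥ z.1 + z.2 ⬝ᵥ A *ᵥ w.1) + s ^ 2 * pairForm A w := by
    ext s
    simp only [pairForm, Prod.snd_add, Prod.fst_add, Prod.smul_snd, Prod.smul_fst, mulVec_add,
      mulVec_smul, dotProduct_add, add_dotProduct, smul_dotProduct, dotProduct_smul, smul_eq_mul]
    ring
  rw [h]
  have := (((hasDerivAt_id (0 : ℂ)).mul_const (w.2 ⬝ᵥ A *ᵥ z.1 + z.2 ⬝ᵥ A *ᵥ w.1)).const_add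
    (pairForm A z)).fun_add (((hasDerivAt_id (0 : ℂ)).fun_pow 2).mul_const (pairForm A w))
  simpa using this.deriv

theorem contDiff_snd_vecMul (A : Matrix ι ι ℂ) (j : ι) :
    ContDiff ℂ 1 (fun z : (ι → ℂ) × (ι → ℂ) => (z.2 ᵥ* A) j) := by
  unfold vecMul dotProduct
  fun_prop

theorem fderiv_snd_vecMul (A : Matrix ι ι ℂ) (j : ι) (z w : (ι → ℂ) × (ι → ℂ)) :
    fderiv ℂ (fun z : (ι → ℂ) × (ι → ℂ) => (z.2 ᵥ* A) j) z w = (w.2 ᵥ* A) j := by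
  rw [← ((contDiff_snd_vecMul A j).differentiable (by norm_num) z).lineDeriv_eq_fderiv, lineDeriv]
  simp only [Prod.snd_add, Prod.smul_snd, add_vecMul, smul_vecMul, Pi.add_apply, Pi.smul_apply,
    smul_eq_mul]
  have := ((hasDerivAt_id (0 : ℂ)).mul_const ((w.2 ᵥ* A) j)).const_add ((z.2 ᵥ* A) j)
  exact this.deriv.trans (one_mul _)

/-- The polarized fidelity polynomial of a family of Kraus operators. -/
def krausForm (K : σ → Matrix ι ι ℂ) (z : (ι → ℂ) × (ι → ℂ)) : ℂ :=
  ∑ s, pairForm (K s) z * pairForm (K s)ᴴ z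

/-- The coefficients of the holomorphic variable in `krausForm`. -/
def krausCovector (K : σ → Matrix ι ι ℂ) (j : ι) (z : (ι → ℂ) × (ι → ℂ)) : ℂ :=
  ∑ s, pairForm (K s) z * (z.2 ᵥ* (K s)ᴴ) j

/-- The Kraus operators weighted by their conjugate traces. -/
def krausTraceSum (K : σ → Matrix ι ι ℂ) : Matrix ι ι ℂ := ∑ s, star (K s).trace • K s

theorem contDiff_krausForm (K : σ → Matrix ι ι ℂ) : ContDiff ℂ 1 (krausForm K) :=
  ContDiff.sum fun _ _ => (contDiff_pairForm _).mul (contDiff_pairForm _)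

theorem contDiff_krausCovector (K : σ → Matrix ι ι ℂ) (j : ι) :
    ContDiff ℂ 1 (krausCovector K j) :=
  ContDiff.sum fun _ _ => (contDiff_pairForm _).mul (contDiff_snd_vecMul _ _)

theorem fderiv_krausForm (K : σ → Matrix ι ι ℂ) (z w : (ι → ℂ) × (ι → ℂ)) :
    fderiv ℂ (krausForm K) z w = ∑ s,
      (pairForm (K s) z * (w.2 ⬝ᵥ (K s)ᴴ *ᵥ z.1 + z.2 ⬝ᵥ (K s)ᴴ *ᵥ w.1) +
        pairForm (K s)ᴴ z * (w.2 ⬝ᵥ K s *ᵥ z.1 + z.2 ⬝ᵥ K s *ᵥ w.1)) := by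
  have hd : ∀ A : Matrix ι ι ℂ, HasFDerivAt (pairForm A) (fderiv ℂ (pairForm A) z) z := fun A =>
    ((contDiff_pairForm A).differentiable (by norm_num) z).hasFDerivAt
  have h := HasFDerivAt.fun_sum (u := Finset.univ) fun s _ => (hd (K s)).fun_mul (hd (K s)ᴴ)
  rw [show krausForm K = fun z => ∑ s, pairForm (K s) z * pairForm (K s)ᴴ z from rfl, h.fderiv]
  simp [fderiv_pairForm]

theorem fderiv_krausCovector (K : σ → Matrix ι ι ℂ) (j : ι) (z w : (ι → ℂ) × (ι → ℂ)) :
    fderiv ℂ (krausCovector K j) z w = ∑ s,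
      (pairForm (K s) z * (w.2 ᵥ* (K s)ᴴ) j +
        (z.2 ᵥ* (K s)ᴴ) j * (w.2 ⬝ᵥ K s *ᵥ z.1 + z.2 ⬝ᵥ K s *ᵥ w.1)) := by
  have hd : ∀ A : Matrix ι ι ℂ, HasFDerivAt (pairForm A) (fderiv ℂ (pairForm A) z) z := fun A =>
    ((contDiff_pairForm A).differentiable (by norm_num) z).hasFDerivAt
  have hd' : ∀ A : Matrix ι ι ℂ, HasFDerivAt (fun z : (ι → ℂ) × (ι → ℂ) => (z.2 ᵥ* A) j)
      (fderiv ℂ (fun z : (ι → ℂ) × (ι → ℂ) => (z.2 ᵥ* A) j) z) z := fun A =>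
    ((contDiff_snd_vecMul A j).differentiable (by norm_num) z).hasFDerivAt
  have h := HasFDerivAt.fun_sum (u := Finset.univ) fun s _ => (hd (K s)).fun_mul (hd' (K s)ᴴ)
  rw [show krausCovector K j = fun z => ∑ s, pairForm (K s) z * (z.2 ᵥ* (K s)ᴴ) j from rfl,
    h.fderiv]
  simp [fderiv_pairForm, fderiv_snd_vecMul]

/-- Euler's identity: the form is homogeneous of degree 2 in the first vector. -/
theorem fderiv_krausForm_fst (K : σ → Matrix ι ι ℂ) (z : (ι → ℂ) × (ι → ℂ)) :
    fderiv ℂ (krausForm K) z (z.1, 0) = 2 * krausForm K z := by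
  rw [fderiv_krausForm, krausForm, Finset.mul_sum]
  refine Finset.sum_congr rfl fun s _ => ?_
  simp only [pairForm, zero_dotProduct, zero_add]
  ring

theorem sum_krausCovector_mul (K : σ → Matrix ι ι ℂ) (z : (ι → ℂ) × (ι → ℂ)) (u : ι → ℂ) :
    ∑ j, krausCovector K j z * u j = ∑ s, pairForm (K s) z * (z.2 ⬝ᵥ (K s)ᴴ *ᵥ u) := by
  simp only [krausCovector, Finset.sum_mul]
  rw [Finset.sum_comm]
  refine Finset.sum_congr rfl fun s _ => ?_
  rw [dotProduct_mulVec, dotProduct, Finset.mul_sum]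
  simp [mul_assoc]

theorem sum_mul_fderiv_krausCovector_fst (K : σ → Matrix ι ι ℂ) (z : (ι → ℂ) × (ι → ℂ)) :
    ∑ j, z.1 j * fderiv ℂ (krausCovector K j) z (z.1, 0) = krausForm K z := by
  have h : ∀ j, fderiv ℂ (krausCovector K j) z (z.1, 0) = krausCovector K j z := by
    intro j
    rw [fderiv_krausCovector, krausCovector]
    refine Finset.sum_congr rfl fun s _ => ?_
    simp [pairForm, mul_comm]
  simp_rw [h, mul_comm (z.1 _), sum_krausCovector_mul]
  rfl

variable [DecidableEq ι]

/-- By the product rule, differentiating `pairForm (K s)` contracts K_s against its adjoint and sums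
to 1 by completeness; differentiating the covector leaves the trace of the adjoint, which is how the
traces enter the average. -/
theorem sum_fderiv_krausCovector_snd {K : σ → Matrix ι ι ℂ} (hK : ∑ s, (K s)ᴴ * K s = 1)
    {z : (ι → ℂ) × (ι → ℂ)} (hz : z.2 ⬝ᵥ z.1 = 1) :
    ∑ j, fderiv ℂ (krausCovector K j) z (0, Pi.single j 1) =
      1 + pairForm (krausTraceSum K) z := by
  have h1 : ∑ s, z.2 ⬝ᵥ ((K s)ᴴ * K s) *ᵥ z.1 = 1 := by
    rw [← dotProduct_sum, ← sum_mulVec, hK, one_mulVec, hz]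
  have h2 : pairForm (krausTraceSum K) z = ∑ s, pairForm (K s) z * (K s)ᴴ.trace := by
    rw [pairForm, krausTraceSum, sum_mulVec, dotProduct_sum]
    refine Finset.sum_congr rfl fun s _ => ?_
    rw [smul_mulVec, dotProduct_smul, trace_conjTranspose, smul_eq_mul, mul_comm, pairForm]
  refine Eq.trans ?_ (congrArg₂ (· + ·) h1 h2.symm)
  rw [← Finset.sum_add_distrib]
  simp_rw [fderiv_krausCovector]
  rw [Finset.sum_comm]
  refine Finset.sum_congr rfl fun s _ => ?_
  rw [Finset.sum_add_distrib, add_comm]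
  congr 1
  · rw [← mulVec_mulVec, dotProduct_mulVec z.2 (K s)ᴴ]
    change _ = ∑ j, (z.2 ᵥ* (K s)ᴴ) j * (K s *ᵥ z.1) j
    refine Finset.sum_congr rfl fun j _ => ?_
    simp
  · simp [trace, Finset.mul_sum]

end Matrix

/-- The remainder in the Stein identity for the recovery fidelity. -/
noncomputable def Matrix.krausRemainder {ι σ : Type*} [Fintype ι] [Fintype σ]
    (K : σ → Matrix ι ι ℂ) (z : (ι → ℂ) × (ι → ℂ)) : ℂ :=
  2 * krausForm K z ^ 2 - fderiv ℂ (krausForm K) z (0, fun j => krausCovector K j z) +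
    (2 * krausForm K z * pairForm (krausTraceSum K) z -
      fderiv ℂ (krausForm K) z (0, z.2 ᵥ* krausTraceSum K)) / Fintype.card ι

/-- `I₁` is Stein's identity with the Kraus covector as test field; it leaves the form of
`krausTraceSum`. `I₂`, with the covector of that form as test field, evaluates this leftover up to a
term of order l. -/
theorem haarState.integral_exp_mul_krausForm_sub {n : ℕ} {σ : Type*} [Fintype σ]
    {K : σ → QubitOp n} (hK : ∑ s, (K s)ᴴ * K s = 1) (l : ℂ) :
    ∫ ψ : StateVec n, (fun z => Complex.exp (l * krausForm K z) *
      ((2 ^ n + 1) * krausForm K z - (1 + (krausTraceSum K).trace / 2 ^ n) +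
        l * krausRemainder K z)) (ψ.1.ofLp, star ψ.1.ofLp) ∂(haarState n) = 0 := by
  have hFc := (contDiff_krausForm K).continuous
  have hF'c := (contDiff_krausForm K).continuous_fderiv (by norm_num)
  have htc := fun j => (contDiff_krausCovector K j).continuous
  have hqc := (contDiff_pairForm (krausTraceSum K)).continuous
  have hpair : Continuous fun ψ : StateVec n => (ψ.1.ofLp, star ψ.1.ofLp) := by fun_prop
  have h1 := haarState.integral_exp_mul_stein (contDiff_krausForm K) (contDiff_krausCovector K) l
  have h2 := haarState.integral_exp_mul_stein (contDiff_krausForm K)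
    (contDiff_snd_vecMul (krausTraceSum K)) l
  set I₁ : (Fin (2 ^ n) → ℂ) × (Fin (2 ^ n) → ℂ) → ℂ := fun z => Complex.exp (l * krausForm K z) *
    (2 ^ n * krausForm K z + krausForm K z - (1 + pairForm (krausTraceSum K) z) +
      l * (2 * krausForm K z * krausForm K z -
        fderiv ℂ (krausForm K) z (0, fun j => krausCovector K j z))) with hI₁
  set I₂ : (Fin (2 ^ n) → ℂ) × (Fin (2 ^ n) → ℂ) → ℂ := fun z => Complex.exp (l * krausForm K z) *
    (2 ^ n * pairForm (krausTraceSum K) z - (krausTraceSum K).trace +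
      l * (2 * krausForm K z * pairForm (krausTraceSum K) z -
        fderiv ℂ (krausForm K) z (0, z.2 ᵥ* krausTraceSum K))) with hI₂
  have e1 : ∫ ψ : StateVec n, I₁ (ψ.1.ofLp, star ψ.1.ofLp) ∂(haarState n) = 0 := by
    refine Eq.trans (integral_congr_ae (ae_of_all _ fun ψ => ?_)) h1
    have hz : (ψ.1.ofLp, star ψ.1.ofLp).2 ⬝ᵥ (ψ.1.ofLp, star ψ.1.ofLp).1 = 1 :=
      StateVec.star_dotProduct_self ψ
    beta_reduce
    generalize (ψ.1.ofLp, star ψ.1.ofLp) = z at hz ⊢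
    simp only [hI₁, sum_mul_fderiv_krausCovector_fst, fderiv_krausForm_fst,
      sum_fderiv_krausCovector_snd hK hz]
    rw [sum_krausCovector_mul]
    rfl
  have e2 : ∫ ψ : StateVec n, I₂ (ψ.1.ofLp, star ψ.1.ofLp) ∂(haarState n) = 0 := by
    refine Eq.trans (integral_congr_ae (ae_of_all _ fun ψ => ?_)) h2
    beta_reduce
    generalize (ψ.1.ofLp, star ψ.1.ofLp) = z
    have h3 : ∀ z : (Fin (2 ^ n) → ℂ) × (Fin (2 ^ n) → ℂ),
        ∑ j, (z.2 ᵥ* krausTraceSum K) j * z.1 j = pairForm (krausTraceSum K) z := fun z =>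
      (dotProduct_mulVec _ _ _).symm
    have h4 : ∑ j, ((Pi.single j 1 : Fin (2 ^ n) → ℂ) ᵥ* krausTraceSum K) j =
        (krausTraceSum K).trace := by simp [trace]
    simp only [hI₂, fderiv_snd_vecMul, fderiv_krausForm_fst, zero_vecMul, Pi.zero_apply, mul_zero,
      Finset.sum_const_zero, add_zero, h3, h4]
  have c1 : Continuous I₁ := by fun_prop
  have c2 : Continuous I₂ := by fun_prop
  -- The weight 1/2^n is the one that cancels the form of `krausTraceSum` outside the remainder.
  calc _ = ∫ ψ : StateVec n, (I₁ (ψ.1.ofLp, star ψ.1.ofLp) +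
        (1 / 2 ^ n) * I₂ (ψ.1.ofLp, star ψ.1.ofLp)) ∂(haarState n) := by
        congr 1; ext ψ
        simp only [hI₁, hI₂, krausRemainder, Fintype.card_fin]
        push_cast
        field_simp
        ring
    _ = 0 := by
        have i1 := (c1.comp hpair).integrable_haarState
        have i2 := ((c2.comp hpair).integrable_haarState.const_mul (1 / 2 ^ n))
        simp only [Function.comp_def] at i1 i2
        rw [integral_add i1 i2, integral_const_mul, e1, e2]
        simp

/-! ### Dimension-free bounds on the remainder -/

theorem norm_sum_mul_sq_le {ι : Type*} [Fintype ι] (u v : ι → ℂ) :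
    ‖∑ i, u i * v i‖ ^ 2 ≤ (∑ i, ‖u i‖ ^ 2) * ∑ i, ‖v i‖ ^ 2 := by
  have h1 : ‖∑ i, u i * v i‖ ≤ ∑ i, ‖u i‖ * ‖v i‖ := by
    simpa using norm_sum_le Finset.univ fun i => u i * v i
  exact (pow_le_pow_left₀ (norm_nonneg _) h1 2).trans
    (Finset.sum_mul_sq_le_sq_mul_sq Finset.univ _ _)

theorem star_dotProduct_self_eq_sum_norm_sq {ι : Type*} [Fintype ι] (u : ι → ℂ) :
    star u ⬝ᵥ u = ((∑ i, ‖u i‖ ^ 2 : ℝ) : ℂ) := by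
  simp [dotProduct, Complex.conj_mul']

namespace Matrix

variable {ι σ : Type*} [Fintype ι] [Fintype σ]

/-- Duality: a covector's norm is controlled by pairing it with its own conjugate and cancelling one
factor. -/
theorem sum_norm_sq_le_of_sq_le {u : ι → ℂ} {r : ℝ}
    (h : ‖∑ i, u i * star (u i)‖ ^ 2 ≤ r * ∑ i, ‖u i‖ ^ 2) (hr : 0 ≤ r) : ∑ i, ‖u i‖ ^ 2 ≤ r := by
  have e : ‖∑ i, u i * star (u i)‖ = ∑ i, ‖u i‖ ^ 2 := by
    have := star_dotProduct_self_eq_sum_norm_sq u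
    rw [dotProduct_comm] at this
    rw [show ∑ i, u i * star (u i) = u ⬝ᵥ star u from rfl, this, Complex.norm_real,
      Real.norm_of_nonneg (Finset.sum_nonneg fun _ _ => by positivity)]
  rw [e] at h
  have h0 : 0 ≤ ∑ i, ‖u i‖ ^ 2 := Finset.sum_nonneg fun _ _ => by positivity
  by_contra! hlt
  nlinarith

theorem trace_krausTraceSum (K : σ → Matrix ι ι ℂ) :
    (krausTraceSum K).trace = ((∑ s, ‖(K s).trace‖ ^ 2 : ℝ) : ℂ) := by
  simp [krausTraceSum, trace_sum, Complex.conj_mul']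

theorem star_dotProduct_conjTranspose_mulVec (A : Matrix ι ι ℂ) (u w : ι → ℂ) :
    star (u ⬝ᵥ Aᴴ *ᵥ w) = star w ⬝ᵥ A *ᵥ star u := by
  rw [← star_dotProduct_star, star_mulVec, conjTranspose_conjTranspose, ← dotProduct_mulVec]

variable [DecidableEq ι] {K : σ → Matrix ι ι ℂ}

/-- Completeness makes w ↦ (K_s w)_s an isometry; then apply Cauchy–Schwarz for each s. -/
theorem sum_norm_dotProduct_mulVec_sq_le (hK : ∑ s, (K s)ᴴ * K s = 1) (u w : ι → ℂ) :
    ∑ s, ‖u ⬝ᵥ K s *ᵥ w‖ ^ 2 ≤ (∑ i, ‖u i‖ ^ 2) * ∑ i, ‖w i‖ ^ 2 := by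
  have h : ∑ s, ∑ i, ‖(K s *ᵥ w) i‖ ^ 2 = ∑ i, ‖w i‖ ^ 2 := by
    have h1 : ∑ s, star (K s *ᵥ w) ⬝ᵥ (K s *ᵥ w) = star w ⬝ᵥ w := by
      simp_rw [star_mulVec, ← dotProduct_mulVec, mulVec_mulVec]
      rw [← dotProduct_sum, ← sum_mulVec, hK, one_mulVec]
    simp_rw [star_dotProduct_self_eq_sum_norm_sq] at h1
    exact_mod_cast h1
  rw [← h, Finset.mul_sum]
  exact Finset.sum_le_sum fun s _ => norm_sum_mul_sq_le u _

/-- Conjugating the scalar swaps the two vectors and removes the adjoint, so no unitality condition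
on ∑ K_s K_s* is needed. -/
theorem sum_norm_dotProduct_conjTranspose_mulVec_sq_le (hK : ∑ s, (K s)ᴴ * K s = 1)
    (u w : ι → ℂ) :
    ∑ s, ‖u ⬝ᵥ (K s)ᴴ *ᵥ w‖ ^ 2 ≤ (∑ i, ‖u i‖ ^ 2) * ∑ i, ‖w i‖ ^ 2 := by
  have h := sum_norm_dotProduct_mulVec_sq_le hK (star w) (star u)
  simp only [Pi.star_apply, norm_star] at h
  rw [mul_comm]
  refine le_trans (le_of_eq (Finset.sum_congr rfl fun s _ => ?_)) h
  rw [← norm_star, star_dotProduct_conjTranspose_mulVec]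

variable {z : (ι → ℂ) × (ι → ℂ)}

theorem sum_norm_pairForm_sq_le (hK : ∑ s, (K s)ᴴ * K s = 1) (h1 : ∑ i, ‖z.1 i‖ ^ 2 = 1)
    (h2 : ∑ i, ‖z.2 i‖ ^ 2 = 1) : ∑ s, ‖pairForm (K s) z‖ ^ 2 ≤ 1 := by
  simpa [pairForm, h1, h2] using sum_norm_dotProduct_mulVec_sq_le hK z.2 z.1

theorem sum_norm_pairForm_conjTranspose_sq_le (hK : ∑ s, (K s)ᴴ * K s = 1)
    (h1 : ∑ i, ‖z.1 i‖ ^ 2 = 1) (h2 : ∑ i, ‖z.2 i‖ ^ 2 = 1) :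
    ∑ s, ‖pairForm (K s)ᴴ z‖ ^ 2 ≤ 1 := by
  simpa [pairForm, h1, h2] using sum_norm_dotProduct_conjTranspose_mulVec_sq_le hK z.2 z.1

theorem norm_krausForm_le (hK : ∑ s, (K s)ᴴ * K s = 1) (h1 : ∑ i, ‖z.1 i‖ ^ 2 = 1)
    (h2 : ∑ i, ‖z.2 i‖ ^ 2 = 1) : ‖krausForm K z‖ ≤ 1 := by
  refine (sq_le_one_iff₀ (norm_nonneg _)).mp ((norm_sum_mul_sq_le _ _).trans ?_)
  exact mul_le_one₀ (sum_norm_pairForm_sq_le hK h1 h2) (Finset.sum_nonneg fun _ _ => by positivity)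
    (sum_norm_pairForm_conjTranspose_sq_le hK h1 h2)

theorem norm_fderiv_krausForm_snd_le (hK : ∑ s, (K s)ᴴ * K s = 1) (h1 : ∑ i, ‖z.1 i‖ ^ 2 = 1)
    (h2 : ∑ i, ‖z.2 i‖ ^ 2 = 1) {u : ι → ℂ} {r : ℝ} (hr : 0 ≤ r) (hu : ∑ i, ‖u i‖ ^ 2 ≤ r ^ 2) :
    ‖fderiv ℂ (krausForm K) z (0, u)‖ ≤ 2 * r := by
  have e : fderiv ℂ (krausForm K) z (0, u) =
      (∑ s, pairForm (K s) z * (u ⬝ᵥ (K s)ᴴ *ᵥ z.1)) +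
        ∑ s, pairForm (K s)ᴴ z * (u ⬝ᵥ K s *ᵥ z.1) := by
    rw [fderiv_krausForm, ← Finset.sum_add_distrib]
    simp
  have b1 := sum_norm_dotProduct_mulVec_sq_le hK u z.1
  have b2 := sum_norm_dotProduct_conjTranspose_mulVec_sq_le hK u z.1
  rw [h1, mul_one] at b1 b2
  have c : ∀ a b : σ → ℂ, ∑ s, ‖a s‖ ^ 2 ≤ 1 → ∑ s, ‖b s‖ ^ 2 ≤ r ^ 2 →
      ‖∑ s, a s * b s‖ ≤ r := by
    intro a b ha hb
    refine (sq_le_sq₀ (norm_nonneg _) hr).mp ((norm_sum_mul_sq_le a b).trans ?_)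
    calc _ ≤ 1 * r ^ 2 := by gcongr
      _ = r ^ 2 := one_mul _
  rw [e, two_mul]
  exact (norm_add_le _ _).trans (add_le_add
    (c _ _ (sum_norm_pairForm_sq_le hK h1 h2) (b2.trans hu))
    (c _ _ (sum_norm_pairForm_conjTranspose_sq_le hK h1 h2) (b1.trans hu)))

theorem sum_norm_krausCovector_sq_le (hK : ∑ s, (K s)ᴴ * K s = 1) (h1 : ∑ i, ‖z.1 i‖ ^ 2 = 1)
    (h2 : ∑ i, ‖z.2 i‖ ^ 2 = 1) : ∑ j, ‖krausCovector K j z‖ ^ 2 ≤ 1 := by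
  refine sum_norm_sq_le_of_sq_le ?_ zero_le_one
  rw [sum_krausCovector_mul K z fun j => star (krausCovector K j z)]
  refine (norm_sum_mul_sq_le _ _).trans ?_
  have b := sum_norm_dotProduct_conjTranspose_mulVec_sq_le hK z.2
    fun j => star (krausCovector K j z)
  simp only [h2, norm_star, one_mul] at b
  exact mul_le_mul (sum_norm_pairForm_sq_le hK h1 h2) b
    (Finset.sum_nonneg fun _ _ => by positivity) zero_le_one

theorem norm_dotProduct_krausTraceSum_mulVec_sq_le (hK : ∑ s, (K s)ᴴ * K s = 1) (u w : ι → ℂ) :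
    ‖u ⬝ᵥ krausTraceSum K *ᵥ w‖ ^ 2 ≤
      (∑ s, ‖(K s).trace‖ ^ 2) * ((∑ i, ‖u i‖ ^ 2) * ∑ i, ‖w i‖ ^ 2) := by
  have e : u ⬝ᵥ krausTraceSum K *ᵥ w = ∑ s, star (K s).trace * (u ⬝ᵥ K s *ᵥ w) := by
    rw [krausTraceSum, sum_mulVec, dotProduct_sum]
    refine Finset.sum_congr rfl fun s _ => ?_
    rw [smul_mulVec, dotProduct_smul, smul_eq_mul]
  rw [e]
  refine (norm_sum_mul_sq_le _ _).trans ?_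
  simp only [norm_star]
  exact mul_le_mul_of_nonneg_left (sum_norm_dotProduct_mulVec_sq_le hK u w)
    (Finset.sum_nonneg fun _ _ => by positivity)

/-- The first line of the remainder contributes 2 + 2. In the second, the trace form and its
covector have norm at most the dimension d, so it contributes (2d + 2d)/d. -/
theorem norm_krausRemainder_le [Nonempty ι] (hK : ∑ s, (K s)ᴴ * K s = 1)
    (h1 : ∑ i, ‖z.1 i‖ ^ 2 = 1) (h2 : ∑ i, ‖z.2 i‖ ^ 2 = 1)
    (htr : ∑ s, ‖(K s).trace‖ ^ 2 ≤ (Fintype.card ι : ℝ) ^ 2) : ‖krausRemainder K z‖ ≤ 8 := by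
  have hd : 0 < (Fintype.card ι : ℝ) := by exact_mod_cast Fintype.card_pos
  have f1 := norm_krausForm_le hK h1 h2
  have f2 := norm_fderiv_krausForm_snd_le hK h1 h2 zero_le_one
    ((sum_norm_krausCovector_sq_le hK h1 h2).trans (one_pow 2).ge)
  have q1 : ‖pairForm (krausTraceSum K) z‖ ≤ Fintype.card ι := by
    refine (sq_le_sq₀ (norm_nonneg _) hd.le).mp ?_
    have := norm_dotProduct_krausTraceSum_mulVec_sq_le hK z.2 z.1
    rw [h1, h2, mul_one, mul_one] at this
    exact this.trans htr
  have q2 : ∑ j, ‖(z.2 ᵥ* krausTraceSum K) j‖ ^ 2 ≤ (Fintype.card ι : ℝ) ^ 2 := by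
    refine sum_norm_sq_le_of_sq_le ?_ (by positivity)
    have := norm_dotProduct_krausTraceSum_mulVec_sq_le hK z.2
      (fun j => star ((z.2 ᵥ* krausTraceSum K) j))
    rw [dotProduct_mulVec, h2, one_mul] at this
    simp only [norm_star] at this
    exact this.trans (mul_le_mul_of_nonneg_right htr (Finset.sum_nonneg fun _ _ => by positivity))
  have q3 := norm_fderiv_krausForm_snd_le hK h1 h2 hd.le q2
  have hA : ‖2 * krausForm K z ^ 2 -
      fderiv ℂ (krausForm K) z (0, fun j => krausCovector K j z)‖ ≤ 4 := by
    refine (norm_sub_le _ _).trans ?_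
    rw [norm_mul, norm_pow, RCLike.norm_ofNat]
    nlinarith [norm_nonneg (krausForm K z)]
  have hB : ‖(2 * krausForm K z * pairForm (krausTraceSum K) z -
      fderiv ℂ (krausForm K) z (0, z.2 ᵥ* krausTraceSum K)) / Fintype.card ι‖ ≤ 4 := by
    rw [norm_div, RCLike.norm_natCast, div_le_iff₀ hd]
    refine (norm_sub_le _ _).trans ?_
    rw [norm_mul, norm_mul, RCLike.norm_ofNat]
    nlinarith [mul_le_mul f1 q1 (norm_nonneg _) zero_le_one]
  exact (norm_add_le _ _).trans (by linarith)

end Matrix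

theorem StateVec.sum_norm_sq {n : ℕ} (ψ : StateVec n) : ∑ i, ‖ψ.1.ofLp i‖ ^ 2 = 1 := by
  have := StateVec.star_dotProduct_self ψ
  rw [star_dotProduct_self_eq_sum_norm_sq] at this
  exact_mod_cast this

theorem krausForm_stateVec {n : ℕ} {σ : Type*} [Fintype σ] (K : σ → QubitOp n) (ψ : StateVec n) :
    krausForm K (ψ.1.ofLp, star ψ.1.ofLp) =
      ((∑ s, ‖star ψ.1.ofLp ⬝ᵥ K s *ᵥ ψ.1.ofLp‖ ^ 2 : ℝ) : ℂ) := by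
  rw [krausForm, Complex.ofReal_sum]
  refine Finset.sum_congr rfl fun s _ => ?_
  have h : pairForm (K s)ᴴ (ψ.1.ofLp, star ψ.1.ofLp) =
      star (pairForm (K s) (ψ.1.ofLp, star ψ.1.ofLp)) := by
    rw [eq_comm, star_eq_iff_star_eq]
    simp only [pairForm]
    rw [star_dotProduct_conjTranspose_mulVec, star_star]
  rw [h, RCLike.star_def, Complex.mul_conj']
  simp [pairForm]

/-! ### From Stein's identity to sub-Gaussian concentration -/

/-- A Grönwall argument: the hypothesis bounds |M'| by V|t|M for M = `mgf X μ`, so M(t) exp(-Vt²/2)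
increases up to t = 0, where it equals 1, and decreases afterwards. -/
theorem ProbabilityTheory.hasSubgaussianMGF_of_abs_integral_mul_exp_le {Ω : Type*}
    [MeasurableSpace Ω] {μ : Measure Ω} [IsProbabilityMeasure μ] {X : Ω → ℝ} {V : NNReal}
    (hint : ∀ t : ℝ, Integrable (fun ω => Real.exp (t * X ω)) μ)
    (h : ∀ t : ℝ, |∫ ω, X ω * Real.exp (t * X ω) ∂μ| ≤ |t| * V * mgf X μ t) :
    HasSubgaussianMGF X V μ := by
  have hset : integrableExpSet X μ = Set.univ := Set.eq_univ_of_forall hint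
  set φ : ℝ → ℝ := fun t => mgf X μ t * Real.exp (-(V * t ^ 2 / 2)) with hφ
  have hd : ∀ t, HasDerivAt φ
      ((∫ ω, X ω * Real.exp (t * X ω) ∂μ - V * t * mgf X μ t) *
        Real.exp (-(V * t ^ 2 / 2))) t := by
    intro t
    have h1 : HasDerivAt (mgf X μ) (∫ ω, X ω * Real.exp (t * X ω) ∂μ) t :=
      hasDerivAt_mgf (by rw [hset, interior_univ]; trivial)
    have h2 : HasDerivAt (fun t : ℝ => Real.exp (-(V * t ^ 2 / 2)))
        (Real.exp (-(V * t ^ 2 / 2)) * -(V * t)) t := by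
      have := (((hasDerivAt_pow 2 t).const_mul (V : ℝ)).div_const 2).fun_neg.exp
      exact this.congr_deriv (by push_cast; ring)
    exact (h1.fun_mul h2).congr_deriv (by ring)
  have h0 : φ 0 = 1 := by simp [hφ]
  have hφ1 : ∀ t, φ t ≤ 1 := by
    intro t
    rcases le_total 0 t with ht | ht
    · have hanti : AntitoneOn φ (Set.Ici 0) := by
        refine antitoneOn_of_deriv_nonpos (convex_Ici 0)
          (fun s _ => (hd s).continuousAt.continuousWithinAt)
          (fun s _ => (hd s).differentiableAt.differentiableWithinAt) fun s hs => ?_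
        rw [interior_Ici, Set.mem_Ioi] at hs
        rw [(hd s).deriv]
        have := (abs_le.mp (h s)).2
        rw [abs_of_pos hs] at this
        exact mul_nonpos_of_nonpos_of_nonneg (by linarith) (Real.exp_pos _).le
      exact (hanti Set.self_mem_Ici ht ht).trans h0.le
    · have hmono : MonotoneOn φ (Set.Iic 0) := by
        refine monotoneOn_of_deriv_nonneg (convex_Iic 0)
          (fun s _ => (hd s).continuousAt.continuousWithinAt)
          (fun s _ => (hd s).differentiableAt.differentiableWithinAt) fun s hs => ?_
        rw [interior_Iic, Set.mem_Iio] at hs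
        rw [(hd s).deriv]
        have := (abs_le.mp (h s)).1
        rw [abs_of_neg hs] at this
        exact mul_nonneg (by linarith) (Real.exp_pos _).le
      exact (hmono ht Set.self_mem_Iic ht).trans h0.le
  refine ⟨hint, fun t => ?_⟩
  have := hφ1 t
  rw [hφ] at this
  beta_reduce at this
  rwa [Real.exp_neg, ← div_eq_mul_inv, div_le_one (Real.exp_pos _)] at this

variable {n m : ℕ} (Comp : QubitChannel n m) (Decomp : QubitChannel m n)

theorem continuous_recoveryFidelity : Continuous (recoveryFidelity Comp Decomp) := by
  obtain ⟨σ, _, K, -, -, hF⟩ := exists_kraus_recoveryFidelity Comp Decomp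
  rw [funext hF]
  unfold dotProduct mulVec dotProduct
  fun_prop

/-- The recovery fidelity satisfies an approximate Stein equation around an explicit centre. -/
theorem exists_recoveryFidelity_stein (hmn : m ≤ n) :
    ∃ c ≤ ((2 : ℝ) ^ m + 1) / (2 ^ n + 1), ∀ t : ℝ,
      |∫ ψ, (recoveryFidelity Comp Decomp ψ - c) * Real.exp (t * recoveryFidelity Comp Decomp ψ)
        ∂(haarState n)| ≤
      |t| * (8 / (2 ^ n + 1)) *
        ∫ ψ, Real.exp (t * recoveryFidelity Comp Decomp ψ) ∂(haarState n) := by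
  have hcont := continuous_recoveryFidelity Comp Decomp
  obtain ⟨σ, _, K, hK, htr, hF⟩ := exists_kraus_recoveryFidelity Comp Decomp
  set g := recoveryFidelity Comp Decomp
  set κ : ℝ := ∑ s, ‖(K s).trace‖ ^ 2 with hκ
  have hd : (0 : ℝ) < 2 ^ n := by positivity
  -- The centre is forced by the case t = 0, and κ ≤ 2^n 2^m bounds it.
  refine ⟨(1 + κ / 2 ^ n) / (2 ^ n + 1), ?_, fun t => ?_⟩
  · rw [add_comm ((2 : ℝ) ^ m)]
    gcongr
    rwa [div_le_iff₀' hd]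
  set c : ℝ := (1 + κ / 2 ^ n) / (2 ^ n + 1) with hc
  have hg : ∀ ψ : StateVec n, krausForm K (ψ.1.ofLp, star ψ.1.ofLp) = (g ψ : ℂ) := fun ψ => by
    rw [krausForm_stateVec, hF]
  have hRc : Continuous fun ψ : StateVec n => krausRemainder K (ψ.1.ofLp, star ψ.1.ofLp) := by
    have hFc := (contDiff_krausForm K).continuous
    have hF'c := (contDiff_krausForm K).continuous_fderiv (by norm_num)
    have htc := fun j => (contDiff_krausCovector K j).continuous
    have hqc := (contDiff_pairForm (krausTraceSum K)).continuous
    unfold krausRemainder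
    fun_prop
  have hR : ∀ ψ : StateVec n, ‖krausRemainder K (ψ.1.ofLp, star ψ.1.ofLp)‖ ≤ 8 := by
    intro ψ
    refine norm_krausRemainder_le hK ψ.sum_norm_sq (by simpa using ψ.sum_norm_sq) ?_
    rw [Fintype.card_fin]; push_cast
    refine htr.trans ?_
    rw [sq]
    gcongr
    norm_num
  have h := haarState.integral_exp_mul_krausForm_sub hK (t : ℂ)
  have hi1 : Integrable (fun ψ => (((2 ^ n + 1) * ((g ψ - c) * Real.exp (t * g ψ)) : ℝ) : ℂ))
      (haarState n) := Continuous.integrable_haarState (by fun_prop)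
  have hi2 : Integrable (fun ψ : StateVec n => (t : ℂ) * ((Real.exp (t * g ψ) : ℝ) *
      krausRemainder K (ψ.1.ofLp, star ψ.1.ofLp))) (haarState n) :=
    Continuous.integrable_haarState (by fun_prop)
  have h' : ∫ ψ : StateVec n, ((((2 ^ n + 1) * ((g ψ - c) * Real.exp (t * g ψ)) : ℝ) : ℂ) +
      (t : ℂ) * ((Real.exp (t * g ψ) : ℝ) *
      krausRemainder K (ψ.1.ofLp, star ψ.1.ofLp))) ∂(haarState n) = 0 := by
    rw [← h]
    congr 1; ext ψ
    beta_reduce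
    rw [hg, trace_krausTraceSum, ← hκ, hc]
    push_cast
    have : (2 ^ n + 1 : ℂ) ≠ 0 := by exact_mod_cast (by positivity : (2 ^ n + 1 : ℝ) ≠ 0)
    field_simp
  rw [integral_add hi1 hi2, integral_complex_ofReal, integral_const_mul, integral_const_mul,
    add_eq_zero_iff_eq_neg] at h'
  have h3 := congrArg norm h'
  rw [norm_neg, norm_mul, Complex.norm_real, Complex.norm_real, norm_mul,
    Real.norm_of_nonneg (by positivity : (0 : ℝ) ≤ 2 ^ n + 1), Real.norm_eq_abs,
    Real.norm_eq_abs] at h3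
  have h4 : ‖∫ ψ : StateVec n, ((Real.exp (t * g ψ) : ℝ) : ℂ) *
      krausRemainder K (ψ.1.ofLp, star ψ.1.ofLp) ∂(haarState n)‖ ≤
      8 * ∫ ψ, Real.exp (t * g ψ) ∂(haarState n) := by
    rw [← integral_const_mul]
    refine norm_integral_le_of_norm_le (Continuous.integrable_haarState (by fun_prop))
      (ae_of_all _ fun ψ => ?_)
    rw [norm_mul, Complex.norm_real, Real.norm_of_nonneg (Real.exp_pos _).le, mul_comm]
    exact mul_le_mul_of_nonneg_right (hR ψ) (Real.exp_pos _).le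
  have h5 := mul_le_mul_of_nonneg_left h4 (abs_nonneg t)
  rw [← h3] at h5
  rw [show |t| * (8 / (2 ^ n + 1)) * ∫ ψ, Real.exp (t * g ψ) ∂(haarState n) =
    (|t| * (8 * ∫ ψ, Real.exp (t * g ψ) ∂(haarState n))) / (2 ^ n + 1) by ring,
    le_div_iff₀' (by positivity)]
  exact h5

theorem recoveryFidelity_concentration (hmn : m ≤ n) :
    avgRecoveryFidelity Comp Decomp ≤ ((2 : ℝ) ^ m + 1) / (2 ^ n + 1) ∧
      HasSubgaussianMGF
        (fun ψ => recoveryFidelity Comp Decomp ψ - avgRecoveryFidelity Comp Decomp)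
        (8 / (2 ^ n + 1)) (haarState n) := by
  have hcont := continuous_recoveryFidelity Comp Decomp
  obtain ⟨c, hc, h⟩ := exists_recoveryFidelity_stein Comp Decomp hmn
  -- At t = 0 the right-hand side of the Stein estimate vanishes, so the centre is the mean.
  have havg : avgRecoveryFidelity Comp Decomp = c := by
    have h0 := h 0
    simp only [zero_mul, Real.exp_zero, mul_one, abs_zero, abs_nonpos_iff] at h0
    rw [integral_sub hcont.integrable_haarState (integrable_const _), sub_eq_zero] at h0
    simpa [avgRecoveryFidelity] using h0
  refine ⟨havg ▸ hc, ?_⟩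
  rw [havg]
  refine hasSubgaussianMGF_of_abs_integral_mul_exp_le
    (fun t => Continuous.integrable_haarState (by fun_prop)) fun t => ?_
  have e1 : ∀ ψ, Real.exp (t * (recoveryFidelity Comp Decomp ψ - c)) =
      Real.exp (-(t * c)) * Real.exp (t * recoveryFidelity Comp Decomp ψ) := fun ψ => by
    rw [← Real.exp_add]; ring_nf
  simp only [mgf, e1, mul_left_comm _ (Real.exp (-(t * c)))]
  rw [integral_const_mul, integral_const_mul, abs_mul, abs_of_pos (Real.exp_pos _)]
  have := mul_le_mul_of_nonneg_left (h t) (Real.exp_pos (-(t * c))).le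
  push_cast
  linarith

theorem recoveryFidelity_tail (hmn : m ≤ n) {t : ℝ} (ht : 0 ≤ t) :
    (haarState n).real
        {ψ | t ≤ recoveryFidelity Comp Decomp ψ - avgRecoveryFidelity Comp Decomp} ≤
      Real.exp (-((2 ^ n + 1) * t ^ 2 / 16)) := by
  refine ((recoveryFidelity_concentration Comp Decomp hmn).2.measure_ge_le ht).trans_eq ?_
  push_cast
  congr 1
  field_simp
  ring

theorem recoveryFidelity_abs_tail (hmn : m ≤ n) {t : ℝ} (ht : 0 ≤ t) :
    (haarState n).real
        {ψ | t ≤ |recoveryFidelity Comp Decomp ψ - avgRecoveryFidelity Comp Decomp|} ≤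
      2 * Real.exp (-((2 ^ n + 1) * t ^ 2 / 16)) := by
  have h1 := recoveryFidelity_tail Comp Decomp hmn ht
  have h2 := (recoveryFidelity_concentration Comp Decomp hmn).2.neg.measure_ge_le ht
  have e : -t ^ 2 / (2 * ((8 / (2 ^ n + 1) : NNReal) : ℝ)) = -((2 ^ n + 1) * t ^ 2 / 16) := by
    push_cast
    field_simp
    ring
  rw [e] at h2
  refine (measureReal_mono (fun ψ hψ => ?_) (measure_ne_top _ _)).trans
    ((measureReal_union_le _ _).trans ((add_le_add h1 h2).trans_eq (two_mul _).symm))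
  rw [Set.mem_ofPred_eq, le_abs] at hψ
  exact hψ

/-! ### Comparison with polynomials and conclusion -/

/-- Eventually p(n) < e^n and n < a 2^n. -/
theorem eventually_exp_neg_mul_lt_one_div {p : ℝ[X]}
    (hp : ∀ᶠ n : ℕ in atTop, 0 < p.eval (n : ℝ)) {a : ℝ} (ha : 0 < a) :
    ∀ᶠ n : ℕ in atTop, Real.exp (-(a * (2 ^ n + 1))) < 1 / p.eval (n : ℝ) := by
  have h1 : Tendsto (fun n : ℕ => p.eval (n : ℝ) / Real.exp n) atTop (𝓝 0) :=
    p.tendsto_div_exp_atTop.comp tendsto_natCast_atTop_atTop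
  have h2 : Tendsto (fun n : ℕ => (n : ℝ) / 2 ^ n) atTop (𝓝 0) := by
    simpa using tendsto_pow_const_div_const_pow_of_one_lt 1 (one_lt_two (α := ℝ))
  filter_upwards [hp, h1.eventually (gt_mem_nhds one_pos), h2.eventually (gt_mem_nhds ha)]
    with n hpn h1n h2n
  rw [div_lt_one (Real.exp_pos _)] at h1n
  rw [div_lt_iff₀ (by positivity)] at h2n
  rw [Real.exp_neg, ← one_div]
  refine one_div_lt_one_div_of_lt hpn (h1n.trans (Real.exp_lt_exp.mpr ?_))
  nlinarith

theorem mainTheorem4 :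
    -- the average fidelity bound
    (∀ n m : ℕ, m < n → ∀ (Comp : QubitChannel n m) (Decomp : QubitChannel m n),
      Integrable (recoveryFidelity Comp Decomp) (haarState n) ∧
      avgRecoveryFidelity Comp Decomp ≤ ((2 : ℝ) ^ m + 1) / ((2 : ℝ) ^ n + 1)) ∧
    -- concentration around the average
    (∀ n m : ℕ, m < n → ∀ (Comp : QubitChannel n m) (Decomp : QubitChannel m n) (t : ℝ), 0 < t →
      (haarState n).real
          {ψ | t ≤ |recoveryFidelity Comp Decomp ψ - avgRecoveryFidelity Comp Decomp|} ≤
        2 * Real.exp (-(4 * (1 / (18 * Real.pi ^ 3)) * (2 : ℝ) ^ n * t ^ 2 / 4 ^ 2))) ∧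
    -- incompressibility
    (∀ ε : ℕ → ℝ, Negligible ε →
      ∀ p : ℝ[X], (∀ᶠ n : ℕ in atTop, 0 < p.eval (n : ℝ)) →
        ∀ᶠ n : ℕ in atTop, ∀ m : ℕ, m < n →
          ¬ ∃ (Comp : QubitChannel n m) (Decomp : QubitChannel m n),
            1 / p.eval (n : ℝ) ≤
              (haarState n).real {ψ | 1 - ε n ≤ recoveryFidelity Comp Decomp ψ}) := by
  refine ⟨fun n m hmn Comp Decomp => ⟨?_, ?_⟩, fun n m hmn Comp Decomp t ht => ?_,
    fun ε hε p hp => ?_⟩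
  · exact (continuous_recoveryFidelity Comp Decomp).integrable_haarState
  · exact (recoveryFidelity_concentration Comp Decomp hmn.le).1
  · refine (recoveryFidelity_abs_tail Comp Decomp hmn.le ht.le).trans ?_
    have hpi : 1 ≤ Real.pi ^ 3 := one_le_pow₀ (by linarith [Real.pi_gt_three])
    -- The exponent already obtained is (2^n + 1)t²/16, so 4C ≤ 1 is all that is needed of C.
    have hC : 1 / (18 * Real.pi ^ 3) ≤ 1 / 4 := by
      gcongr
      linarith
    have hnt : 0 ≤ (2 : ℝ) ^ n * t ^ 2 := by positivity
    refine mul_le_mul_of_nonneg_left (Real.exp_le_exp.mpr (neg_le_neg ?_)) zero_le_two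
    nlinarith [mul_le_mul_of_nonneg_right hC hnt, sq_nonneg t]
  -- Only ε → 0 matters. With mean at most 2/3 and ε < 1/12, success forces a deviation of at least
  -- 1/4 = 1 - 1/12 - 2/3, and 1/256 = (1/4)²/16 is the resulting rate.
  · have hε0 : Tendsto ε atTop (𝓝 0) := by simpa using hε 0
    filter_upwards [eventually_exp_neg_mul_lt_one_div hp (by norm_num : (0 : ℝ) < 1 / 256),
      hε0.eventually (gt_mem_nhds (by norm_num : (0 : ℝ) < 1 / 12))] with n hpn hεn m hmn
    rintro ⟨Comp, Decomp, h⟩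
    have hm : (2 : ℝ) * 2 ^ m ≤ 2 ^ n := by
      rw [← pow_succ']
      exact pow_le_pow_right₀ one_le_two hmn
    have hm1 : (1 : ℝ) ≤ 2 ^ m := one_le_pow₀ one_le_two
    -- The ratio (2^m + 1)/(2·2^m + 1) is largest at m = 0, where it equals 2/3.
    have hc : avgRecoveryFidelity Comp Decomp ≤ 2 / 3 := by
      refine (recoveryFidelity_concentration Comp Decomp hmn.le).1.trans ?_
      rw [div_le_div_iff₀ (by positivity) (by norm_num)]
      linarith
    have htail := recoveryFidelity_tail Comp Decomp hmn.le (by norm_num : (0 : ℝ) ≤ 1 / 4)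
    have hsub : (haarState n).real {ψ | 1 - ε n ≤ recoveryFidelity Comp Decomp ψ} ≤
        (haarState n).real {ψ | 1 / 4 ≤
          recoveryFidelity Comp Decomp ψ - avgRecoveryFidelity Comp Decomp} :=
      measureReal_mono (fun ψ hψ => by
        simp only [Set.mem_ofPred_eq] at hψ ⊢
        linarith) (measure_ne_top _ _)
    have := (h.trans hsub).trans htail
    rw [show -(((2 : ℝ) ^ n + 1) * (1 / 4) ^ 2 / 16) = -(1 / 256 * (2 ^ n + 1)) by ring] at this
    exact absurd hpn this.not_gt
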